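/- Let $H_1$ and $H_2$ be (real or complex) Hilbert spaces over the same field, and let $S\colon H_1\to H_2$ and $T\colon H_2\to H_1$ be bounded linear operators, with null spaces $N(\cdot)$, ranges $R(\cdot)$ and Hilbert space adjoints $S^*\colon H_2\to H_1$ and $T^*\colon H_1\to H_2$. The pair $(S,T)$ is called a Fredholm pair if the dimensions $$a=\dim \frac{N(S)}{N(S)\cap R(T)},\quad b=\dim \frac{R(T)}{N(S)\cap R(T)},\quad c=\dim \frac{N(T)}{N(T)\cap R(S)},\quad d=\dim \frac{R(S)}{N(T)\cap R(S)}$$ are all finite, and in this case its index is the integer $\operatorname{ind}(S,T)=a-b-c+d$. Then $(S,T)$ is a Fredholm pair if and only if $(T^*,S^*)$ is a Fredholm pair. Furthermore, in this case $$\operatorname{ind}(T^*,S^*)=\operatorname{ind}(S,T).$$ -/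

import Mathlib

open scoped InnerProduct

noncomputable section

namespace FredholmPair

variable {𝕜 : Type*} [RCLike 𝕜] {H₁ H₂ : Type*}
  [NormedAddCommGroup H₁] [InnerProductSpace 𝕜 H₁]
  [NormedAddCommGroup H₂] [InnerProductSpace 𝕜 H₂]

/-- The quotient vector space `M / (M ∩ N)` for two linear subspaces `M`, `N` of `H₁`. -/
abbrev InterQuot (M N : Submodule 𝕜 H₁) : Type _ :=
  ↥M ⧸ (M ⊓ N).submoduleOf M

/-- `(S, T)` is a Fredholm pair: the four quotients `N(S) / (N(S) ∩ R(T))`,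
`R(T) / (N(S) ∩ R(T))`, `N(T) / (N(T) ∩ R(S))` and `R(S) / (N(T) ∩ R(S))` are
finite dimensional. -/
structure IsFredholmPair (S : H₁ →L[𝕜] H₂) (T : H₂ →L[𝕜] H₁) : Prop where
  finite_a : FiniteDimensional 𝕜 (InterQuot S.ker T.range)
  finite_b : FiniteDimensional 𝕜 (InterQuot T.range S.ker)
  finite_c : FiniteDimensional 𝕜 (InterQuot T.ker S.range)
  finite_d : FiniteDimensional 𝕜 (InterQuot S.range T.ker)

/-- The index `a - b - c + d` of a pair `(S, T)`, where `a`, `b`, `c`, `d` are the dimensions of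
the four quotients above. It is meaningful for Fredholm pairs. -/
def index (S : H₁ →L[𝕜] H₂) (T : H₂ →L[𝕜] H₁) : ℤ :=
  (Module.finrank 𝕜 (InterQuot S.ker T.range) : ℤ)
    - (Module.finrank 𝕜 (InterQuot T.range S.ker) : ℤ)
    - (Module.finrank 𝕜 (InterQuot T.ker S.range) : ℤ)
    + (Module.finrank 𝕜 (InterQuot S.range T.ker) : ℤ)

end FredholmPair

end

namespace FredholmPair

variable {𝕜 : Type*} [RCLike 𝕜] {E F : Type*}
  [NormedAddCommGroup E] [InnerProductSpace 𝕜 E]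
  [NormedAddCommGroup F] [InnerProductSpace 𝕜 F]

/-! Finiteness of `a` and `b` forces `R(T)` to be closed, and `c`, `d` do the same for `R(S)`. Hence
`R(S*) = N(S)ᗮ` and `R(T*) = N(T)ᗮ`, while `N(T*) = R(T)ᗮ` and `N(S*) = R(S)ᗮ` always. The duality
`N / (N ∩ M) ≃ Mᗮ / (Mᗮ ∩ Nᗮ)` then preserves `a`, `b`, `c`, `d` one by one. The converse follows
from `A** = A`. -/

/-- The restriction of a bounded operator to the orthogonal complement of its kernel is
injective. -/
theorem ker_domRestrict_orthogonal_ker (A : E →L[𝕜] F) :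
    (A ∘L A.kerᗮ.subtypeL).ker = ⊥ := by
  rw [LinearMap.ker_eq_bot']
  intro x hx
  have h1 : (x : E) ∈ A.ker := hx
  have h2 : (x : E) ∈ A.ker ⊓ A.kerᗮ := ⟨h1, x.2⟩
  rw [Submodule.inf_orthogonal_eq_bot] at h2
  exact Subtype.ext h2

variable [CompleteSpace E]

/-- Restricting a bounded operator to the orthogonal complement of its kernel does not change its
range. -/
theorem range_domRestrict_orthogonal_ker (A : E →L[𝕜] F) :
    (A ∘L A.kerᗮ.subtypeL).range = A.range := by
  refine le_antisymm ?_ ?_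
  · rintro _ ⟨x, rfl⟩
    exact ⟨x, rfl⟩
  · rintro _ ⟨x, rfl⟩
    refine ⟨⟨x - A.ker.starProjection x, Submodule.sub_starProjection_mem_orthogonal x⟩, ?_⟩
    have h : A (A.ker.starProjection x) = 0 := Submodule.starProjection_apply_mem A.ker x
    simp [h]

variable [CompleteSpace F]

/-- A bounded operator whose range has finite codimension has closed range. -/
theorem isClosed_range_of_finiteDimensional_quotient (A : E →L[𝕜] F)
    [FiniteDimensional 𝕜 (F ⧸ A.range)] : IsClosed (A.range : Set F) := by
  obtain ⟨G, hG⟩ := Submodule.exists_isCompl A.range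
  have : FiniteDimensional 𝕜 G :=
    (Submodule.quotientEquivOfIsCompl A.range G hG).finiteDimensional
  rw [← range_domRestrict_orthogonal_ker] at hG ⊢
  exact ContinuousLinearMap.closed_complemented_range_of_isCompl_of_ker_eq_bot _ G hG
    G.closed_of_finiteDimensional (ker_domRestrict_orthogonal_ker A)

/-- If the kernel of `S` and the range of `T` differ by finite dimensions only, then `T` has closed
range. -/
theorem isClosed_range_of_finiteDimensional_interQuot (S : F →L[𝕜] E) (T : E →L[𝕜] F)
    (ha : FiniteDimensional 𝕜 (InterQuot S.ker T.range))
    (hb : FiniteDimensional 𝕜 (InterQuot T.range S.ker)) : IsClosed (T.range : Set F) := by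
  -- `S(R(T)) ≃ R(T) / (R(T) ∩ N(S))` is finite dimensional, hence closed; its preimage under `S` is
  -- `N(S) + R(T)`, a Hilbert space in which `R(T)` has finite codimension.
  have hfin : FiniteDimensional 𝕜 (T.range.map (S : F →ₗ[𝕜] E)) := by
    let f : T.range →ₗ[𝕜] E := (S : F →ₗ[𝕜] E) ∘ₗ T.range.subtype
    have hker : (T.range ⊓ S.ker).submoduleOf T.range = f.ker := by
      ext x
      simp [Submodule.submoduleOf, f]
    have hrange : f.range = T.range.map (S : F →ₗ[𝕜] E) := by
      simp [f, LinearMap.range_comp]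
    rw [← hrange]
    exact ((Submodule.quotEquivOfEq _ _ hker).trans f.quotKerEquivRange).finiteDimensional
  have hY : IsClosed ((S.ker ⊔ T.range : Submodule 𝕜 F) : Set F) := by
    have h := (T.range.map (S : F →ₗ[𝕜] E)).closed_of_finiteDimensional.preimage S.continuous
    have h2 := Submodule.comap_map_eq (S : F →ₗ[𝕜] E) T.range
    rw [sup_comm, ← h2]
    exact h
  have : CompleteSpace (S.ker ⊔ T.range : Submodule 𝕜 F) := hY.completeSpace_coe
  let T' : E →L[𝕜] (S.ker ⊔ T.range : Submodule 𝕜 F) :=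
    T.codRestrict _ fun x => (le_sup_right : T.range ≤ S.ker ⊔ T.range) ⟨x, rfl⟩
  have hT' : T.range.submoduleOf (S.ker ⊔ T.range) = T'.range := by
    ext x
    simp [Submodule.submoduleOf, T', Subtype.ext_iff]
  have hq : FiniteDimensional 𝕜 ((S.ker ⊔ T.range : Submodule 𝕜 F) ⧸ T'.range) :=
    (((Submodule.quotEquivOfEq ((S.ker ⊓ T.range).submoduleOf S.ker) _ rfl).trans
      (LinearMap.quotientInfEquivSupQuotient S.ker T.range)).trans
      (Submodule.quotEquivOfEq _ _ hT')).finiteDimensional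
  have hc := hY.isClosedEmbedding_subtypeVal.isClosedMap _
    (isClosed_range_of_finiteDimensional_quotient T')
  convert! hc
  ext x
  simp [T']

/-- Part of the closed range theorem: if `A` has closed range, then the range of its adjoint is the
orthogonal complement of the kernel of `A`. -/
theorem range_adjoint_eq_orthogonal_ker (A : E →L[𝕜] F) (hA : IsClosed (A.range : Set F)) :
    (ContinuousLinearMap.adjoint A).range = A.kerᗮ := by
  refine le_antisymm ?_ fun x hx => ?_
  · rw [ContinuousLinearMap.orthogonal_ker]
    exact Submodule.le_topologicalClosure _
  · rw [← range_domRestrict_orthogonal_ker] at hA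
    have hinj := LinearMap.ker_eq_bot.mp (ker_domRestrict_orthogonal_ker A)
    have : CompleteSpace (A ∘L A.kerᗮ.subtypeL).range := hA.completeSpace_coe
    let e := (A ∘L A.kerᗮ.subtypeL).equivRange hinj hA
    -- With `e` the restriction of `A` to `A.kerᗮ`, `⟪x, z⟫ = ⟪x, e⁻¹ (A z)⟫ = ⟪(e⁻¹)* x, A z⟫`.
    let y := ContinuousLinearMap.adjoint 
      (e.symm : (A ∘L A.kerᗮ.subtypeL).range →L[𝕜] A.kerᗮ) ⟨x, hx⟩
    refine ⟨y, ext_inner_right 𝕜 fun z => ?_⟩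
    let w : A.kerᗮ := ⟨z - A.ker.starProjection z, Submodule.sub_starProjection_mem_orthogonal z⟩
    have hk : A (A.ker.starProjection z) = 0 := Submodule.starProjection_apply_mem A.ker z
    have hAz : A z = (e w : F) := by
      change A z = A (z - A.ker.starProjection z)
      simp [hk]
    have hx0 : inner 𝕜 x (A.ker.starProjection z) = 0 :=
      Submodule.inner_left_of_mem_orthogonal (Submodule.starProjection_apply_mem A.ker z) hx
    change inner 𝕜 (ContinuousLinearMap.adjoint A (y : F)) z = _
    rw [ContinuousLinearMap.adjoint_inner_left, hAz, ← Submodule.coe_inner,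
      ContinuousLinearMap.adjoint_inner_left]
    change inner 𝕜 (⟨x, hx⟩ : A.kerᗮ) (e.symm (e w)) = _
    rw [e.symm_apply_apply]
    simp [w, Submodule.coe_inner, inner_sub_right, hx0]

/-- For a closed subspace `M`, if `N / (N ∩ M)` is finite dimensional, then it is isomorphic to
`Mᗮ / (Mᗮ ∩ Nᗮ)`. -/
theorem nonempty_interQuot_orthogonal_equiv (M N : Submodule 𝕜 E) (hM : IsClosed (M : Set E))
    (hN : FiniteDimensional 𝕜 (InterQuot N M)) :
    Nonempty (InterQuot N M ≃ₗ[𝕜] InterQuot Mᗮ Nᗮ) := by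
  have : CompleteSpace M := hM.completeSpace_coe
  let p : N →ₗ[𝕜] E := (Mᗮ.starProjection : E →ₗ[𝕜] E) ∘ₗ N.subtype
  have hp : (N ⊓ M).submoduleOf N = p.ker := by
    ext x
    have h : x ∈ p.ker ↔ (x : E) ∈ Mᗮᗮ := Submodule.starProjection_apply_eq_zero_iff Mᗮ
    rw [h, Submodule.orthogonal_orthogonal]
    simp [Submodule.submoduleOf]
  let e := (Submodule.quotEquivOfEq _ _ hp).trans p.quotKerEquivRange
  have : FiniteDimensional 𝕜 p.range := e.finiteDimensional
  have hle : p.range ≤ Mᗮ := by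
    rintro _ ⟨x, rfl⟩
    exact Submodule.starProjection_apply_mem _ _
  -- `p` and `q` have the same range, the projection of `N` to `Mᗮ`. The kernel of `q` is `Mᗮ ∩ Nᗮ`,
  -- since `⟪p n, x⟫ = ⟪n, x⟫` for `x` in `Mᗮ`.
  let q : Mᗮ →ₗ[𝕜] p.range := (p.range.orthogonalProjectionOnto : E →ₗ[𝕜] p.range) ∘ₗ Mᗮ.subtype
  have hq : q.ker = (Mᗮ ⊓ Nᗮ).submoduleOf Mᗮ := by
    ext x
    have h1 : x ∈ q.ker ↔ (x : E) ∈ p.rangeᗮ := by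
      simp [q, Submodule.orthogonalProjectionOnto_eq_zero_iff]
    have h2 : ∀ n, inner 𝕜 (n - M.starProjection n) (x : E) = inner 𝕜 n (x : E) := fun n => by
      rw [inner_sub_left, Submodule.inner_right_of_mem_orthogonal
        (Submodule.starProjection_apply_mem M n) x.2, sub_zero]
    rw [h1]
    simp [Submodule.submoduleOf, Submodule.mem_orthogonal, p, h2]
  have hsurj : Function.Surjective q := fun y =>
    ⟨⟨y, hle y.2⟩, by simp [q]⟩
  exact ⟨e.trans (((Submodule.quotEquivOfEq _ _ hq.symm).trans
    (q.quotKerEquivOfSurjective hsurj)).symm)⟩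

/-- The four quotients of a Fredholm pair are isomorphic to those of the adjoint pair. -/
theorem IsFredholmPair.adjoint_and_index_eq {S : E →L[𝕜] F} {T : F →L[𝕜] E}
    (h : IsFredholmPair S T) :
    IsFredholmPair (ContinuousLinearMap.adjoint T) (ContinuousLinearMap.adjoint S) ∧
      index (ContinuousLinearMap.adjoint T) (ContinuousLinearMap.adjoint S) = index S T := by
  obtain ⟨ha, hb, hc, hd⟩ := h
  have hT := isClosed_range_of_finiteDimensional_interQuot S T ha hb
  have hS := isClosed_range_of_finiteDimensional_interQuot T S hc hd
  obtain ⟨ea⟩ := nonempty_interQuot_orthogonal_equiv _ _ hT ha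
  obtain ⟨eb⟩ := nonempty_interQuot_orthogonal_equiv _ _ S.isClosed_ker hb
  obtain ⟨ec⟩ := nonempty_interQuot_orthogonal_equiv _ _ hS hc
  obtain ⟨ed⟩ := nonempty_interQuot_orthogonal_equiv _ _ T.isClosed_ker hd
  rw [T.orthogonal_range, ← range_adjoint_eq_orthogonal_ker S hS] at ea eb
  rw [S.orthogonal_range, ← range_adjoint_eq_orthogonal_ker T hT] at ec ed
  refine ⟨⟨ea.finiteDimensional, eb.finiteDimensional, ec.finiteDimensional,
    ed.finiteDimensional⟩, ?_⟩
  rw [index, index, ea.finrank_eq, eb.finrank_eq, ec.finrank_eq, ed.finrank_eq]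

end FredholmPair

theorem theorem4p3 {𝕜 : Type*} [RCLike 𝕜] {H₁ H₂ : Type*}
    [NormedAddCommGroup H₁] [InnerProductSpace 𝕜 H₁] [CompleteSpace H₁]
    [NormedAddCommGroup H₂] [InnerProductSpace 𝕜 H₂] [CompleteSpace H₂]
    (S : H₁ →L[𝕜] H₂) (T : H₂ →L[𝕜] H₁) :
    (FredholmPair.IsFredholmPair S T ↔
      FredholmPair.IsFredholmPair
        (ContinuousLinearMap.adjoint T) (ContinuousLinearMap.adjoint S)) ∧
    (FredholmPair.IsFredholmPair S T →
      FredholmPair.index (ContinuousLinearMap.adjoint T) (ContinuousLinearMap.adjoint S) =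
        FredholmPair.index S T) := by
  refine ⟨⟨fun h => h.adjoint_and_index_eq.1, fun h => ?_⟩, fun h => h.adjoint_and_index_eq.2⟩
  simpa only [ContinuousLinearMap.adjoint_adjoint] using h.adjoint_and_index_eq.1
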